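/- Let $F$ be a field of characteristic zero and let $E$ be the Grassmann algebra over $F$ of a vector space with basis $e_1,e_2,\dots$, so that $1$ and the monomials $w=e_{i_1}\cdots e_{i_k}$ with $i_1<\dots<i_k$ form a basis of $E$; $k$ is the length of $w$ and $\{e_{i_1},\dots,e_{i_k}\}$ is its support (the monomial $1$ has length $0$ and empty support). Let $m<0<n$ be integers. Let $E_{(m,n)}^{(\infty,\infty)}=\bigoplus_{r\in\mathbb Z}A_r$ be the $\mathbb Z$-grading of $E$ obtained by giving degree $m$ to infinitely many of the generators $e_i$ and degree $n$ to the remaining ones, also infinitely many; the degree of a monomial is the sum of the degrees of its factors, and $A_r$ is the span of the monomials of degree $r$. Suppose that $m\cdot n$ is even and that there are non-negative integers $\alpha,\beta,\alpha',\beta'$ with $$1=\alpha m+\beta n,\qquad -1=\alpha' m+\beta' n,$$ and with $\alpha+\beta$ and $\alpha'+\beta'$ both odd (so that, in particular, $\gcd(m,n)=1$ and the grading has full support; $\alpha+\beta$ and $\alpha'+\beta'$ are not required to be minimal). Then $E_{(m,n)}^{(\infty,\infty)}$ generates the variety $\mathfrak V_1^{\mathbb Z}$ of $\mathbb Z$-graded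 algebras defined by the graded identities $[x_1,x_2,x_3]=[[x_1,x_2],x_3]$, for all degrees of the variables $x_1,x_2,x_3$. That is, in the free associative algebra $F\langle X|\mathbb Z\rangle$ on countably many variables of each degree $g\in\mathbb Z$, the ideal of all $\mathbb Z$-graded polynomial identities of $E_{(m,n)}^{(\infty,\infty)}$ is equal to the $T_{\mathbb Z}$-ideal (two-sided ideal invariant under all graded endomorphisms) generated by these polynomials. Moreover, for every $r\in\mathbb Z$ there is a set of monomials in $A_r$ with pairwise disjoint supports that contains infinitely many monomials of even length and infinitely many monomials of odd length. -/

import Mathlib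

noncomputable section

namespace GradedGrassmann

/-! ### The Grassmann algebra, its canonical basis and the gradings induced by degrees of the
generators -/

/-- The Grassmann algebra `E` of a vector space with basis `e_0, e_1, e_2, …` over `F`. -/
abbrev Grassmann (F : Type*) [Field F] : Type _ := ExteriorAlgebra F (ℕ →₀ F)

/-- The canonical basis `B_E` of the Grassmann algebra, indexed by the supports of its elements:
the finite set `{i₁ < ⋯ < i_k}` indexes the monomial `e_{i₁} ⋯ e_{i_k}` of length `k`. -/
def monomialBasis (F : Type*) [Field F] : Module.Basis (Finset ℕ) F (Grassmann F) :=
  (Finsupp.basisSingleOne (R := F) (ι := ℕ)).ExteriorAlgebra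

/-- The degree of the monomial with support `s`, if the generator `e_i` has degree `d i`. -/
def monomialDegree (d : ℕ → ℤ) (s : Finset ℕ) : ℤ := ∑ i ∈ s, d i

/-- The homogeneous component of degree `r` of the Grassmann algebra, if the generator `e_i` has
degree `d i`: the span of all monomials of degree `r`. -/
def component (F : Type*) [Field F] (d : ℕ → ℤ) (r : ℤ) : Submodule F (Grassmann F) :=
  Submodule.span F {w | ∃ s : Finset ℕ, monomialDegree d s = r ∧ w = monomialBasis F s}

/-- `d` is a choice of degrees of the generators that gives the grading `E_{(m,n)}^{(∞,∞)}`: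
infinitely many generators have degree `m`, infinitely many have degree `n`, and there are
no others. -/
structure IsTwoInduced (d : ℕ → ℤ) (m n : ℤ) : Prop where
  degree_eq : ∀ i, d i = m ∨ d i = n
  infinite_left : {i | d i = m}.Infinite
  infinite_right : {i | d i = n}.Infinite

section Grading

variable (F : Type*) [Field F] (d : ℕ → ℤ)

theorem monomialBasis_mem (s : Finset ℕ) :
    monomialBasis F s ∈ component F d (monomialDegree d s) :=
  Submodule.subset_span ⟨s, rfl, rfl⟩

/-- The monomial indexed by `s` is the product of the generators `e_i`, `i ∈ s`, in increasing
order. -/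
theorem monomialBasis_eq_prod (s : Finset ℕ) :
    monomialBasis F s =
      (List.ofFn fun k : Fin s.card =>
        ExteriorAlgebra.ι F (Finsupp.single (s.orderEmbOfFin rfl k) (1 : F))).prod := by
  rw [monomialBasis, ExteriorAlgebra.basis_apply_ofCard _ rfl, ExteriorAlgebra.ιMulti_family,
    ExteriorAlgebra.ιMulti_apply]
  congr 2

theorem monomialBasis_empty : monomialBasis F ∅ = 1 := by
  rw [monomialBasis_eq_prod]; simp

instance component_gradedMonoid : SetLike.GradedMonoid (component F d) where
  one_mem := by
    rw [← monomialBasis_empty F]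
    simpa [monomialDegree] using monomialBasis_mem F d ∅
  mul_mem := by
    intro i j x y hx hy
    induction hx using Submodule.span_induction with
    | zero => simp
    | add a b _ _ ha hb => rw [add_mul]; exact add_mem ha hb
    | smul c a _ ha => rw [smul_mul_assoc]; exact Submodule.smul_mem _ c ha
    | mem a ha =>
      obtain ⟨s, rfl, rfl⟩ := ha
      induction hy using Submodule.span_induction with
      | zero => simp
      | add a b _ _ ha hb => rw [mul_add]; exact add_mem ha hb
      | smul c a _ ha => rw [mul_smul_comm]; exact Submodule.smul_mem _ c ha
      | mem b hb =>
        obtain ⟨t, rfl, rfl⟩ := hb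
        by_cases h : Disjoint s t
        · have := ExteriorAlgebra.basis_mul_of_disjoint (R := F)
            (Finsupp.basisSingleOne (R := F) (ι := ℕ))
            (Set.powersetCard.ofCard (s := s) rfl) (Set.powersetCard.ofCard (s := t) rfl) h
          have key : monomialDegree d s + monomialDegree d t = monomialDegree d (s ∪ t) := by
            simp [monomialDegree, Finset.sum_union h]
          change monomialBasis F s * monomialBasis F t = _ at this
          rw [this, key]
          refine Submodule.smul_of_tower_mem _ _ ?_
          have h2 := monomialBasis_mem F d (s ∪ t)
          rw [← Finset.disjUnion_eq_union s t h] at h2 ⊢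
          exact h2
        · have := ExteriorAlgebra.basis_mul_of_not_disjoint (R := F)
            (Finsupp.basisSingleOne (R := F) (ι := ℕ))
            (Set.powersetCard.ofCard (s := s) rfl) (Set.powersetCard.ofCard (s := t) rfl) h
          change monomialBasis F s * monomialBasis F t = _ at this
          rw [this]
          exact zero_mem _

/-- The components form a decomposition, so that `E` is a `ℤ`-graded algebra. -/
instance component_gradedAlgebra : GradedAlgebra (component F d) where
  toDecomposition := DirectSum.Decomposition.ofLinearMap (component F d)
    ((monomialBasis F).constr F fun s =>
      DirectSum.lof F ℤ (fun r => component F d r) (monomialDegree d s)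
        ⟨monomialBasis F s, monomialBasis_mem F d s⟩)
    (by
      refine (monomialBasis F).ext fun s => ?_
      simp [Module.Basis.constr_basis])
    (by
      refine DirectSum.linearMap_ext F fun r => LinearMap.ext fun ⟨x, hx⟩ => ?_
      simp only [LinearMap.comp_apply, LinearMap.id_apply, DirectSum.coeLinearMap_lof]
      induction hx using Submodule.span_induction with
      | zero => rw [map_zero]; exact (map_zero _).symm
      | add a b ha' hb' ha hb =>
        rw [map_add, ha, hb, ← map_add]
        rfl
      | smul c a ha' ha =>
        rw [map_smul, ha, ← map_smul]
        rfl
      | mem a ha =>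
        obtain ⟨s, rfl, rfl⟩ := ha
        rw [Module.Basis.constr_basis])

end Grading

/-! ### Graded polynomial identities -/

/-- The free associative algebra `F⟨X|ℤ⟩`; the pair `(g, i)` is the `i`-th variable of
degree `g`. -/
abbrev FreeGraded (F : Type*) [Field F] : Type _ := FreeAlgebra F (ℤ × ℕ)

/-- The variable `x_i^g`, of degree `g`. -/
def var (F : Type*) [Field F] (g : ℤ) (i : ℕ) : FreeGraded F := FreeAlgebra.ι F (g, i)

/-- The component of degree `g` of the free algebra: the span of all monomials of degree `g`. -/
def freeComponent (F : Type*) [Field F] (g : ℤ) : Submodule F (FreeGraded F) :=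
  Submodule.span F {w | ∃ l : List (ℤ × ℕ),
    (l.map Prod.fst).sum = g ∧ w = (l.map (FreeAlgebra.ι F)).prod}

/-- An endomorphism of the free algebra is graded if it maps every component into itself. -/
def IsGradedEnd {F : Type*} [Field F] (φ : FreeGraded F →ₐ[F] FreeGraded F) : Prop :=
  ∀ g : ℤ, ∀ f ∈ freeComponent F g, φ f ∈ freeComponent F g

/-- A `T_ℤ`-ideal: a two-sided ideal invariant under all graded endomorphisms. -/
def IsTIdeal {F : Type*} [Field F] (I : TwoSidedIdeal (FreeGraded F)) : Prop :=
  ∀ φ : FreeGraded F →ₐ[F] FreeGraded F, IsGradedEnd φ → ∀ f ∈ I, φ f ∈ I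

/-- The `T_ℤ`-ideal generated by a set of graded polynomials. -/
def tIdealSpan {F : Type*} [Field F] (S : Set (FreeGraded F)) : TwoSidedIdeal (FreeGraded F) :=
  sInf {I | IsTIdeal I ∧ S ⊆ I}

/-- The ideal `T_ℤ(A)` of the graded polynomial identities of a `ℤ`-graded algebra `A`: the
polynomials that vanish under every substitution of elements of `A` of the right degrees
for the variables. -/
def gradedIdentities {F : Type*} [Field F] {A : Type*} [Ring A] [Algebra F A]
    (𝒜 : ℤ → Submodule F A) [GradedAlgebra 𝒜] : TwoSidedIdeal (FreeGraded F) :=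
  .mk' {f | ∀ a : ℤ × ℕ → A, (∀ x, a x ∈ 𝒜 x.1) → FreeAlgebra.lift F a f = 0}
    (fun a _ => map_zero _)
    (fun hf hg a ha => by rw [map_add, hf a ha, hg a ha, add_zero])
    (fun hf a ha => by rw [map_neg, hf a ha, neg_zero])
    (fun hg a ha => by rw [map_mul, hg a ha, mul_zero])
    (fun hf a ha => by rw [map_mul, hf a ha, zero_mul])

/-- The `ℤ`-graded algebra `A` generates the variety of all `ℤ`-graded algebras that satisfy the
graded identities in `S`: the `T_ℤ`-ideal of the variety, which is the `T_ℤ`-ideal generated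
by `S`, is the ideal of all graded identities of `A`. -/
def GeneratesVarietyOf {F : Type*} [Field F] {A : Type*} [Ring A] [Algebra F A]
    (𝒜 : ℤ → Submodule F A) [GradedAlgebra 𝒜] (S : Set (FreeGraded F)) : Prop :=
  tIdealSpan S = gradedIdentities 𝒜

/-- The polynomials `[x₁, x₂, x₃] = [[x₁, x₂], x₃]`, for all degrees of `x₁`, `x₂`, `x₃`; they define
the variety `𝔙₁`. -/
def tripleCommutators (F : Type*) [Field F] : Set (FreeGraded F) :=
  {f | ∃ a b c : ℤ, f = ⁅⁅var F a 1, var F b 2⁆, var F c 3⁆}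

end GradedGrassmann

end

/-! Commutators in `E` are central, so the triple commutators are identities of `E`. Conversely,
modulo the triple commutators every polynomial is a combination of normal forms: an ordered product
of variables, given by a multiset `a`, times a product of commutators that is alternating in its
entries, given by a finite set `J` (`exists_sub_normalForm_mem`). It remains to see that an identity
of `E` forces the coefficients with `J` of even size to vanish (`coeff_eq_zero_of_vanishes`).

To isolate `(a₀, J₀)`, substitute `p x + q x` for `x`: `p x` is a sum of `a₀.count x` even, hence
central, monomials, `q x` is one odd monomial if `x ∈ J₀` and zero otherwise, and all supports are
disjoint. Forms with `J ⊈ J₀` vanish, as do those with `J = J₀` in which some `x` occurs more than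
`a₀.count x` times; induction on the sizes of `J` and `a` removes the others.

Enough monomials exist in every degree because `n` generators of degree `m` and `-m` of degree `n`
have total degree zero and odd total number (`exists_counts_of_parity`). -/

namespace GradedGrassmann

/-! ### Normal forms in algebras with central commutators -/

section LieNilpotent

variable {F A X : Type*} [Field F] [Ring A] [Algebra F A]

/-- Expand `⁅⁅a, b * c⁆, d⁆` by the Leibniz rule. With antisymmetry, this makes products of
commutators alternate in all their entries. -/
theorem lie_mul_lie_swap (h : ∀ a b c : A, ⁅⁅a, b⁆, c⁆ = 0) (a b c d : A) :
    ⁅a, b⁆ * ⁅c, d⁆ = -(⁅a, c⁆ * ⁅b, d⁆) := by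
  have e : ⁅⁅a, b * c⁆, d⁆ = ⁅a, b⁆ * ⁅c, d⁆ + ⁅⁅a, b⁆, d⁆ * c + ⁅a, c⁆ * ⁅b, d⁆
      + ⁅⁅b, d⁆, ⁅a, c⁆⁆ + b * ⁅⁅a, c⁆, d⁆ := by
    simp only [Ring.lie_def]; noncomm_ring
  simp only [h, zero_mul, mul_zero, add_zero] at e
  exact eq_neg_of_add_eq_zero_left e.symm

/-- The product of the commutators of consecutive pairs of entries of a list (zero if the length
is odd), evaluated at the family `x`. -/
def commProd (x : X → A) : List X → A
  | [] => 1
  | [_] => 0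
  | a :: b :: l => ⁅x a, x b⁆ * commProd x l

theorem map_commProd {B G : Type*} [Ring B] [FunLike G A B] [RingHomClass G A B] (φ : G)
    (x : X → A) : ∀ l : List X, φ (commProd x l) = commProd (fun i => φ (x i)) l
  | [] => by simp [commProd]
  | [_] => by simp [commProd]
  | a :: b :: l => by
    simp only [commProd, map_mul, map_commProd φ x l, Ring.lie_def, map_sub]

theorem commProd_of_odd (x : X → A) : ∀ l : List X, Odd l.length → commProd x l = 0
  | [], h => by simp at h
  | [_], _ => rfl
  | a :: b :: l, h => by
    have : Odd l.length := by
      simp only [List.length_cons] at h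
      grind
    simp [commProd, commProd_of_odd x l this]

/-- The parity of the prefix decides whether the two entries share a commutator (antisymmetry) or
straddle two neighbouring ones (`lie_mul_lie_swap`). -/
theorem commProd_append_swap (h : ∀ a b c : A, ⁅⁅a, b⁆, c⁆ = 0) (x : X → A) (a b : X)
    (l : List X) : ∀ p : List X,
      commProd x (p ++ a :: b :: l) = -commProd x (p ++ b :: a :: l)
  | [] => by
    simp only [List.nil_append, commProd]
    rw [Ring.lie_def, Ring.lie_def, ← neg_mul, neg_sub]
  | [c] => by
    cases l with
    | nil => simp [commProd]
    | cons d l =>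
      simp only [List.cons_append, List.nil_append, commProd]
      rw [← mul_assoc, lie_mul_lie_swap h, neg_mul, mul_assoc]
  | c :: d :: p => by
    simp only [List.cons_append, commProd]
    rw [commProd_append_swap h x a b l p, mul_neg]

theorem commProd_perm (h : ∀ a b c : A, ⁅⁅a, b⁆, c⁆ = 0) (x : X → A) {l l' : List X}
    (hl : l.Perm l') : ∀ p : List X, commProd x (p ++ l) = commProd x (p ++ l') ∨
      commProd x (p ++ l) = -commProd x (p ++ l') := by
  induction hl with
  | nil => intro p; exact Or.inl rfl
  | cons a _ ih => intro p; simpa using ih (p ++ [a])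
  | swap a b l => intro p; exact Or.inr (commProd_append_swap h x b a l p)
  | trans _ _ ih₁ ih₂ =>
    intro p
    rcases ih₁ p with h₁ | h₁ <;> rcases ih₂ p with h₂ | h₂ <;> rw [h₁, h₂] <;> simp

/-- Moving both copies of a repeated entry to the front produces a factor `⁅x a, x a⁆`; no division
by 2 is needed. -/
theorem commProd_of_not_nodup (h : ∀ a b c : A, ⁅⁅a, b⁆, c⁆ = 0) (x : X → A) {l : List X}
    (hl : ¬ l.Nodup) : commProd x l = 0 := by
  rw [List.nodup_iff_sublist] at hl
  push Not at hl
  obtain ⟨a, ha⟩ := hl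
  obtain ⟨l', hl'⟩ := ha.exists_perm_append
  have := commProd_perm h x hl' []
  simpa [commProd, Ring.lie_def] using this

open Classical in
theorem exists_commProd_eq (h : ∀ a b c : A, ⁅⁅a, b⁆, c⁆ = 0) (x : X → A) (l : List X) :
    ∃ (c : F) (J : Finset X), commProd x l = c • commProd x J.toList := by
  by_cases hl : l.Nodup
  · have hp : l.Perm l.toFinset.toList := (List.toFinset_toList hl).symm
    rcases commProd_perm h x hp [] with e | e
    · exact ⟨1, l.toFinset, by simpa using e⟩
    · exact ⟨-1, l.toFinset, by simpa using e⟩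
  · exact ⟨0, ∅, by simp [commProd_of_not_nodup h x hl]⟩

/-- The elements `x_{i₁} ⋯ x_{i_k} [x_{j₁}, x_{j₂}] ⋯`, for a multiset of indices `i` and a
finite set of indices `j`. -/
noncomputable def normalForm (x : X → A) (p : Multiset X × Finset X) : A :=
  (p.1.toList.map x).prod * commProd x p.2.toList

theorem map_normalForm {B G : Type*} [Ring B] [FunLike G A B] [RingHomClass G A B] (φ : G)
    (x : X → A) (p : Multiset X × Finset X) :
    φ (normalForm x p) = normalForm (fun i => φ (x i)) p := by
  simp [normalForm, map_commProd, map_list_prod, Function.comp_def]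

/-- Permuting the factors of a product changes it by products of fewer factors with
commutators. -/
theorem prod_mul_commProd_sub_mem (h : ∀ a b c : A, ⁅⁅a, b⁆, c⁆ = 0) (x : X → A)
    {l l' : List X} (hl : l.Perm l') (L : List X) :
    (l.map x).prod * commProd x L - (l'.map x).prod * commProd x L ∈
      Submodule.span F {w | ∃ k K : List X, k.length < l.length ∧
        w = (k.map x).prod * commProd x K} := by
  induction hl with
  | nil => simp
  | @cons a l l' _ ih =>
    have := Submodule.mem_map_of_mem (f := LinearMap.mulLeft F (x a)) ih
    rw [Submodule.map_span] at this
    have e : (LinearMap.mulLeft F (x a)) ((l.map x).prod * commProd x L -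
        (l'.map x).prod * commProd x L) = ((a :: l).map x).prod * commProd x L -
        ((a :: l').map x).prod * commProd x L := by
      simp [mul_sub, mul_assoc]
    rw [e] at this
    refine Submodule.span_mono ?_ this
    rintro _ ⟨_, ⟨k, K, hk, rfl⟩, rfl⟩
    exact ⟨a :: k, K, by simpa using hk, by simp [mul_assoc]⟩
  | swap a b l =>
    -- The error term of the swap is `⁅x b, x a⁆`, which is central and so can join the commutators
    -- in `L`.
    refine Submodule.subset_span ⟨l, b :: a :: L, by simp, ?_⟩
    have hc : ⁅x b, x a⁆ * (l.map x).prod = (l.map x).prod * ⁅x b, x a⁆ :=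
      sub_eq_zero.mp (h _ _ _)
    simp only [List.map_cons, List.prod_cons, commProd]
    rw [← mul_assoc (l.map x).prod, ← hc, Ring.lie_def]
    noncomm_ring
  | trans h₁ _ ih₁ ih₂ =>
    rw [← h₁.length_eq] at ih₂
    simpa using add_mem ih₁ ih₂

/-- Putting the factors in the order chosen by `Multiset.toList` costs only terms with fewer factors
outside the commutators, so induction on that number applies. -/
theorem prod_mul_commProd_mem_span (h : ∀ a b c : A, ⁅⁅a, b⁆, c⁆ = 0) (x : X → A)
    (N : ℕ) : ∀ l L : List X, l.length ≤ N → (l.map x).prod * commProd x L ∈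
      Submodule.span F (Set.range (normalForm x)) := by
  induction N using Nat.strong_induction_on with
  | _ N ih =>
    intro l L hN
    have hp : l.Perm (l : Multiset X).toList :=
      Multiset.coe_eq_coe.mp (Multiset.coe_toList (l : Multiset X)).symm
    have h₁ := prod_mul_commProd_sub_mem (F := F) h x hp L
    have h₂ : Submodule.span F {w | ∃ k K : List X, k.length < l.length ∧
        w = (k.map x).prod * commProd x K} ≤ Submodule.span F (Set.range (normalForm x)) := by
      rw [Submodule.span_le]
      rintro _ ⟨k, K, hk, rfl⟩
      exact ih k.length (by omega) k K le_rfl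
    have h₃ : ((l : Multiset X).toList.map x).prod * commProd x L ∈
        Submodule.span F (Set.range (normalForm x)) := by
      obtain ⟨c, J, e⟩ := exists_commProd_eq (F := F) h x L
      rw [e, mul_smul_comm]
      exact Submodule.smul_mem _ _ (Submodule.subset_span ⟨((l : Multiset X), J), rfl⟩)
    simpa using add_mem (h₂ h₁) h₃

theorem span_monomials_eq_top (F : Type*) [Field F] (X : Type*) :
    Submodule.span F (Set.range fun l : List X => (l.map (FreeAlgebra.ι F)).prod) = ⊤ := by
  rw [eq_top_iff]
  rintro f -
  induction f using FreeAlgebra.induction with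
  | grade0 r =>
    rw [Algebra.algebraMap_eq_smul_one]
    exact Submodule.smul_mem _ _ (Submodule.subset_span ⟨[], by simp⟩)
  | grade1 i => exact Submodule.subset_span ⟨[i], by simp⟩
  | mul a b ha hb =>
    have := Submodule.mul_mem_mul ha hb
    rw [Submodule.span_mul_span] at this
    refine Submodule.span_mono ?_ this
    rintro _ ⟨_, ⟨l, rfl⟩, _, ⟨l', rfl⟩, rfl⟩
    exact ⟨l ++ l', by simp⟩
  | add a b ha hb => exact add_mem ha hb

/-- In an algebra in which commutators are central, the normal forms in a family span the
subalgebra that the family generates. -/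
theorem lift_mem_span_normalForm (h : ∀ a b c : A, ⁅⁅a, b⁆, c⁆ = 0) (x : X → A)
    (f : FreeAlgebra F X) :
    FreeAlgebra.lift F x f ∈ Submodule.span F (Set.range (normalForm x)) := by
  have hf : f ∈ Submodule.span F
      (Set.range fun l : List X => (l.map (FreeAlgebra.ι F)).prod) := by
    rw [span_monomials_eq_top]; trivial
  have := Submodule.mem_map_of_mem (f := (FreeAlgebra.lift F x).toLinearMap) hf
  rw [Submodule.map_span] at this
  refine Submodule.span_le.mpr ?_ this
  rintro _ ⟨_, ⟨l, rfl⟩, rfl⟩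
  have e := prod_mul_commProd_mem_span (F := F) h x _ l [] le_rfl
  simpa [commProd, map_list_prod, Function.comp_def] using e

end LieNilpotent

/-! ### Multiplication of monomials in the Grassmann algebra -/

section Monomials

variable (F : Type*) [Field F]

theorem monomialBasis_mul_of_not_disjoint {s t : Finset ℕ} (h : ¬ Disjoint s t) :
    monomialBasis F s * monomialBasis F t = 0 :=
  ExteriorAlgebra.basis_mul_of_not_disjoint (R := F)
    (Finsupp.basisSingleOne (R := F) (ι := ℕ))
    (Set.powersetCard.ofCard (s := s) rfl) (Set.powersetCard.ofCard (s := t) rfl) h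

theorem exists_monomialBasis_mul {s t : Finset ℕ} (h : Disjoint s t) :
    ∃ c : F, c ≠ 0 ∧ monomialBasis F s * monomialBasis F t = c • monomialBasis F (s ∪ t) := by
  obtain ⟨σ, h'⟩ : ∃ σ : ℤˣ,
      monomialBasis F s * monomialBasis F t = σ • monomialBasis F (s.disjUnion t h) :=
    ⟨_, ExteriorAlgebra.basis_mul_of_disjoint (R := F)
      (Finsupp.basisSingleOne (R := F) (ι := ℕ))
      (Set.powersetCard.ofCard (s := s) rfl) (Set.powersetCard.ofCard (s := t) rfl) h⟩
  rw [Finset.disjUnion_eq_union] at h'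
  rcases Int.units_eq_one_or σ with rfl | rfl
  · exact ⟨1, one_ne_zero, by simpa using h'⟩
  · exact ⟨-1, neg_ne_zero.mpr one_ne_zero, by simpa using h'⟩

theorem ι_mul_prod_comm (v : ℕ →₀ F) (l : List (ℕ →₀ F)) :
    ExteriorAlgebra.ι F v * (l.map (ExteriorAlgebra.ι F)).prod =
      (-1 : F) ^ l.length • ((l.map (ExteriorAlgebra.ι F)).prod * ExteriorAlgebra.ι F v) := by
  induction l with
  | nil => simp
  | cons w l ih =>
    have h : ExteriorAlgebra.ι F v * ExteriorAlgebra.ι F w =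
        -(ExteriorAlgebra.ι F w * ExteriorAlgebra.ι F v) :=
      eq_neg_of_add_eq_zero_left (ExteriorAlgebra.ι_add_mul_swap v w)
    simp only [List.map_cons, List.prod_cons, List.length_cons]
    rw [← mul_assoc, h, neg_mul, mul_assoc, ih, mul_smul_comm, pow_succ, mul_neg_one, neg_smul,
      mul_assoc]

theorem prod_ι_mul_prod_ι_comm (l l' : List (ℕ →₀ F)) :
    (l.map (ExteriorAlgebra.ι F)).prod * (l'.map (ExteriorAlgebra.ι F)).prod =
      (-1 : F) ^ (l.length * l'.length) •
        ((l'.map (ExteriorAlgebra.ι F)).prod * (l.map (ExteriorAlgebra.ι F)).prod) := by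
  induction l with
  | nil => simp
  | cons v l ih =>
    simp only [List.map_cons, List.prod_cons, List.length_cons]
    rw [mul_assoc, ih, mul_smul_comm, ← mul_assoc, ι_mul_prod_comm, smul_mul_assoc, smul_smul,
      mul_assoc, add_mul, one_mul, pow_add]

/-- Supports may overlap: the sign comes from anticommuting generators one at a time. -/
theorem monomialBasis_mul_comm (s t : Finset ℕ) :
    monomialBasis F s * monomialBasis F t =
      (-1 : F) ^ (s.card * t.card) • (monomialBasis F t * monomialBasis F s) := by
  have h : ∀ s : Finset ℕ, monomialBasis F s =
      ((List.ofFn fun k : Fin s.card => Finsupp.single (s.orderEmbOfFin rfl k) (1 : F)).map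
        (ExteriorAlgebra.ι F)).prod := fun s => by
    rw [monomialBasis_eq_prod, List.map_ofFn]; rfl
  rw [h s, h t, prod_ι_mul_prod_ι_comm]
  simp

theorem monomialBasis_mem_center {s : Finset ℕ} (hs : Even s.card) :
    monomialBasis F s ∈ Subalgebra.center F (Grassmann F) := by
  rw [Subalgebra.mem_center_iff]
  intro b
  have : LinearMap.mulRight F (monomialBasis F s) = LinearMap.mulLeft F (monomialBasis F s) := by
    refine (monomialBasis F).ext fun t => ?_
    rw [LinearMap.mulRight_apply, LinearMap.mulLeft_apply, monomialBasis_mul_comm,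
      (hs.mul_left t.card).neg_one_pow, one_smul]
  exact LinearMap.congr_fun this b

theorem monomialBasis_anticomm {s t : Finset ℕ} (hs : Odd s.card) (ht : Odd t.card) :
    monomialBasis F s * monomialBasis F t = -(monomialBasis F t * monomialBasis F s) := by
  rw [monomialBasis_mul_comm, (hs.mul ht).neg_one_pow, neg_one_smul]

/-- By bilinearity only monomials matter. Even ones are central; two odd ones anticommute, so their
commutator is twice a product that is zero or of even length. -/
theorem lie_mem_center (a b : Grassmann F) : ⁅a, b⁆ ∈ Subalgebra.center F (Grassmann F) := by
  have ha : a ∈ Submodule.span F (Set.range (monomialBasis F)) := by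
    rw [(monomialBasis F).span_eq]; trivial
  have hb : b ∈ Submodule.span F (Set.range (monomialBasis F)) := by
    rw [(monomialBasis F).span_eq]; trivial
  induction ha using Submodule.span_induction with
  | zero => simp [Ring.lie_def]
  | add a a' _ _ h h' =>
    have := add_mem h h'
    rwa [show ⁅a, b⁆ + ⁅a', b⁆ = ⁅a + a', b⁆ by simp only [Ring.lie_def]; noncomm_ring] at this
  | smul c a _ h =>
    have := Subalgebra.smul_mem _ h c
    rwa [show c • ⁅a, b⁆ = ⁅c • a, b⁆ by simp [Ring.lie_def, smul_sub]] at this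
  | mem a ha =>
    obtain ⟨s, rfl⟩ := ha
    induction hb using Submodule.span_induction with
    | zero => simp [Ring.lie_def]
    | add b b' _ _ h h' =>
      have := add_mem h h'
      rwa [← show ⁅monomialBasis F s, b + b'⁆ = ⁅monomialBasis F s, b⁆ + ⁅monomialBasis F s, b'⁆ by
        simp only [Ring.lie_def]; noncomm_ring] at this
    | smul c b _ h =>
      have := Subalgebra.smul_mem _ h c
      rwa [show c • ⁅monomialBasis F s, b⁆ = ⁅monomialBasis F s, c • b⁆ by
        simp [Ring.lie_def, smul_sub]] at this
    | mem b hb =>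
      obtain ⟨t, rfl⟩ := hb
      rw [Ring.lie_def]
      rcases Nat.even_or_odd s.card with hs | hs
      · rw [Subalgebra.mem_center_iff.mp (monomialBasis_mem_center F hs), sub_self]
        exact zero_mem _
      rcases Nat.even_or_odd t.card with ht | ht
      · rw [Subalgebra.mem_center_iff.mp (monomialBasis_mem_center F ht), sub_self]
        exact zero_mem _
      rw [monomialBasis_anticomm F hs ht, ← neg_add']
      have h : monomialBasis F t * monomialBasis F s ∈ Subalgebra.center F (Grassmann F) := by
        by_cases hd : Disjoint t s
        · obtain ⟨c, -, e⟩ := exists_monomialBasis_mul F hd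
          rw [e]
          refine Subalgebra.smul_mem _ (monomialBasis_mem_center F ?_) c
          rw [Finset.card_union_of_disjoint hd]
          exact ht.add_odd hs
        · rw [monomialBasis_mul_of_not_disjoint F hd]
          exact zero_mem _
      exact neg_mem (add_mem h h)

theorem lie_lie_eq_zero (a b c : Grassmann F) : ⁅⁅a, b⁆, c⁆ = 0 := by
  rw [Ring.lie_def ⁅a, b⁆, Subalgebra.mem_center_iff.mp (lie_mem_center F a b) c, sub_self]

/-- `z` is a nonzero scalar multiple of the monomial with support `s`. -/
def IsMonomialMultiple (z : Grassmann F) (s : Finset ℕ) : Prop :=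
  ∃ c : F, c ≠ 0 ∧ z = c • monomialBasis F s

variable {F}

theorem IsMonomialMultiple.ne_zero {z : Grassmann F} {s : Finset ℕ}
    (h : IsMonomialMultiple F z s) : z ≠ 0 := by
  obtain ⟨c, hc, rfl⟩ := h
  exact smul_ne_zero hc ((monomialBasis F).ne_zero s)

theorem IsMonomialMultiple.smul {z : Grassmann F} {s : Finset ℕ}
    (h : IsMonomialMultiple F z s) {c : F} (hc : c ≠ 0) : IsMonomialMultiple F (c • z) s := by
  obtain ⟨c', hc', rfl⟩ := h
  exact ⟨c * c', mul_ne_zero hc hc', smul_smul _ _ _⟩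

theorem IsMonomialMultiple.mul {z w : Grassmann F} {s t : Finset ℕ}
    (hz : IsMonomialMultiple F z s) (hw : IsMonomialMultiple F w t) (h : Disjoint s t) :
    IsMonomialMultiple F (z * w) (s ∪ t) := by
  obtain ⟨c, hc, rfl⟩ := hz
  obtain ⟨c', hc', rfl⟩ := hw
  obtain ⟨c'', hc'', e⟩ := exists_monomialBasis_mul F h
  exact ⟨c * c' * c'', mul_ne_zero (mul_ne_zero hc hc') hc'', by
    rw [smul_mul_smul_comm, e, smul_smul]⟩

theorem isMonomialMultiple_monomialBasis (s : Finset ℕ) :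
    IsMonomialMultiple F (monomialBasis F s) s :=
  ⟨1, one_ne_zero, (one_smul _ _).symm⟩

open Classical in
theorem isMonomialMultiple_prod {κ : Type*} {z : κ → Grassmann F} {S : κ → Finset ℕ}
    (hS : Pairwise fun i j => Disjoint (S i) (S j)) (l : List κ) (hl : l.Nodup)
    (hz : ∀ i ∈ l, IsMonomialMultiple F (z i) (S i)) :
    IsMonomialMultiple F (l.map z).prod (l.toFinset.biUnion S) := by
  induction l with
  | nil => exact ⟨1, one_ne_zero, by simp [monomialBasis_empty]⟩
  | cons i l ih =>
    rw [List.nodup_cons] at hl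
    rw [List.map_cons, List.prod_cons, List.toFinset_cons, Finset.biUnion_insert]
    refine (hz i (by simp)).mul (ih hl.2 fun j hj => hz j (by simp [hj])) ?_
    rw [Finset.disjoint_biUnion_right]
    intro j hj
    refine hS fun e => hl.1 ?_
    rw [e]; simpa using hj

end Monomials

/-! ### Powers of sums of commuting square-zero elements -/

section SquareZero

variable {A : Type*} [CommRing A]

theorem add_pow_succ_of_sq_zero (a w : A) (hw : w * w = 0) (k : ℕ) :
    (a + w) ^ (k + 1) = a ^ (k + 1) + (k + 1) * a ^ k * w := by
  induction k with
  | zero => simp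
  | succ k ih =>
    rw [pow_succ, ih]
    push_cast
    linear_combination (k + 1) * a ^ k * hw

/-- A sum of `N` such terms detects the exponent `N`: higher powers vanish, while the `N`-th is `N!`
times the full product. Both claims are needed together, since the vanishing for `N` simplifies both
powers for `N + 1`. -/
theorem sum_pow_of_sq_zero (w : ℕ → A) (hw : ∀ k, w k * w k = 0) (N : ℕ) :
    (∑ k ∈ Finset.range N, w k) ^ (N + 1) = 0 ∧
      (∑ k ∈ Finset.range N, w k) ^ N = N.factorial * ∏ k ∈ Finset.range N, w k := by
  induction N with
  | zero => simp
  | succ N ih =>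
    obtain ⟨h₀, h₁⟩ := ih
    rw [Finset.sum_range_succ, add_pow_succ_of_sq_zero _ _ (hw N),
      add_pow_succ_of_sq_zero _ _ (hw N), Finset.prod_range_succ, pow_succ _ (N + 1), h₀, h₁,
      Nat.factorial_succ]
    push_cast
    constructor <;> ring

end SquareZero

/-! ### Disjoint monomials of prescribed degree and parity -/

section Degrees

variable {d : ℕ → ℤ} {m n : ℤ}

theorem IsTwoInduced.exists_counts (hd : IsTwoInduced d m n) (hmn : m ≠ n) (x y : ℕ)
    (S : Finset ℕ) :
    ∃ s : Finset ℕ, Disjoint s S ∧ s.card = x + y ∧ monomialDegree d s = x * m + y * n := by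
  obtain ⟨s, hs, hsc⟩ := (hd.infinite_left.sdiff S.finite_toSet).exists_subset_card_eq x
  obtain ⟨t, ht, htc⟩ := (hd.infinite_right.sdiff S.finite_toSet).exists_subset_card_eq y
  have hst : Disjoint s t := by
    rw [Finset.disjoint_left]
    intro i hi hi'
    exact hmn ((hs hi).1.symm.trans (ht hi').1)
  refine ⟨s ∪ t, ?_, by rw [Finset.card_union_of_disjoint hst, hsc, htc], ?_⟩
  · rw [Finset.disjoint_left]
    intro i hi
    rcases Finset.mem_union.mp hi with h | h
    · simpa using (hs h).2
    · simpa using (ht h).2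
  · rw [monomialDegree, Finset.sum_union hst, Finset.sum_congr rfl fun i hi => (hs hi).1,
      Finset.sum_congr rfl fun i hi => (ht hi).1]
    simp [hsc, htc]

/-- The numbers of factors of degree `m` and `n` can be chosen freely up to the relation
`n * m + (-m) * n = 0`, which changes the parity of the length. -/
theorem exists_counts_of_parity (hm : m < 0) (hn : 0 < n) (hmn : Even (m * n))
    {α β α' β' : ℕ} (h_one : (1 : ℤ) = α * m + β * n) (h_neg_one : (-1 : ℤ) = α' * m + β' * n)
    (r : ℤ) (b : Bool) :
    ∃ x y : ℕ, (x * m + y * n : ℤ) = r ∧ (Even (x + y) ↔ b = true) ∧ 0 < x + y := by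
  obtain ⟨x₀, y₀, h₀⟩ : ∃ x y : ℕ, (x * m + y * n : ℤ) = r := by
    rcases le_total 0 r with hr | hr
    · lift r to ℕ using hr
      exact ⟨r * α, r * β, by push_cast; linear_combination -(r : ℤ) * h_one⟩
    · obtain ⟨k, rfl⟩ : ∃ k : ℕ, r = -k := ⟨r.natAbs, by omega⟩
      exact ⟨k * α', k * β', by push_cast; linear_combination -(k : ℤ) * h_neg_one⟩
  obtain ⟨a, rfl⟩ : ∃ a : ℕ, m = -a := ⟨m.natAbs, by omega⟩
  lift n to ℕ using hn.le
  -- `m` and `n` are not both even, since they represent 1, but their product is even; so exactly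
  -- one is even.
  have hodd : Odd (n + a) := by
    have h₁ : ¬ (Even (a : ℤ) ∧ Even (n : ℤ)) := by
      rintro ⟨ha, hn'⟩
      have : Even (1 : ℤ) := by
        rw [h_one]; exact (ha.neg.mul_left _).add (hn'.mul_left _)
      exact absurd this (by decide)
    rw [neg_mul, even_neg, Int.even_mul, Int.even_coe_nat, Int.even_coe_nat] at hmn
    rw [Int.even_coe_nat, Int.even_coe_nat] at h₁
    rw [Nat.odd_add]
    grind
  have hpos : 0 < n := by exact_mod_cast hn
  by_cases hp : Even (x₀ + y₀) ↔ b = true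
  -- Adding the zero-degree relation twice keeps the parity and makes the length positive; adding it
  -- once, below, flips the parity.
  · refine ⟨x₀ + 2 * n, y₀ + 2 * a, by push_cast; linear_combination h₀, ?_, by omega⟩
    rw [← hp, show x₀ + 2 * n + (y₀ + 2 * a) = x₀ + y₀ + 2 * (n + a) by ring, Nat.even_add]
    simp
  · refine ⟨x₀ + n, y₀ + a, by push_cast; linear_combination h₀, ?_, by omega⟩
    rw [show x₀ + n + (y₀ + a) = x₀ + y₀ + (n + a) by ring, Nat.even_add]
    rw [← Nat.not_even_iff_odd] at hodd
    tauto

theorem exists_disjoint_sequence {P : ℕ → Finset ℕ → Prop}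
    (h : ∀ k S, ∃ s, Disjoint s S ∧ P k s) :
    ∃ s : ℕ → Finset ℕ, (Pairwise fun i j => Disjoint (s i) (s j)) ∧ ∀ k, P k (s k) := by
  choose g hg hP using h
  -- `acc k` is the union of the sets chosen before stage `k`, which the next choice must avoid.
  let acc : ℕ → Finset ℕ := fun k => Nat.rec ∅ (fun j S => S ∪ g j S) k
  have hacc : ∀ k, acc (k + 1) = acc k ∪ g k (acc k) := fun k => rfl
  have hmono : Monotone acc :=
    monotone_nat_of_le_succ fun k => by rw [hacc]; exact Finset.subset_union_left
  have hlt : ∀ i j, i < j → Disjoint (g j (acc j)) (g i (acc i)) := fun i j hij =>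
    (hg j (acc j)).mono_right <| (Finset.subset_union_right.trans (hacc i).ge).trans (hmono hij)
  refine ⟨fun k => g k (acc k), fun i j hij => ?_, fun k => hP k _⟩
  rcases lt_or_gt_of_ne hij with h | h
  · exact (hlt i j h).symm
  · exact hlt j i h

/-- There is a family of nonempty pairwise disjoint supports that contains infinitely many supports
of each degree and each parity of the length. -/
theorem exists_disjoint_supports (hm : m < 0) (hn : 0 < n) (hmn : Even (m * n))
    {α β α' β' : ℕ} (h_one : (1 : ℤ) = α * m + β * n) (h_neg_one : (-1 : ℤ) = α' * m + β' * n)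
    (hd : IsTwoInduced d m n) :
    ∃ S : ℤ × Bool × ℕ → Finset ℕ, (Pairwise fun i j => Disjoint (S i) (S j)) ∧
      ∀ k, (S k).Nonempty ∧ monomialDegree d (S k) = k.1 ∧
        (Even (S k).card ↔ k.2.1 = true) := by
  obtain ⟨e⟩ : Nonempty (ℤ × Bool × ℕ ≃ ℕ) := nonempty_equiv_of_countable
  obtain ⟨s, hs, hP⟩ := exists_disjoint_sequence (P := fun k s => s.Nonempty ∧
      monomialDegree d s = (e.symm k).1 ∧ (Even s.card ↔ (e.symm k).2.1 = true)) fun k S => by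
    obtain ⟨x, y, h₁, h₂, h₃⟩ := exists_counts_of_parity hm hn hmn h_one h_neg_one
      (e.symm k).1 (e.symm k).2.1
    obtain ⟨s, hs, hc, hdeg⟩ := hd.exists_counts (hm.trans hn).ne x y S
    exact ⟨s, hs, Finset.card_pos.mp (hc ▸ h₃), hdeg.trans h₁, hc ▸ h₂⟩
  exact ⟨fun k => s (e k), fun i j hij => hs (e.injective.ne hij), fun k => by
    simpa using hP (e k)⟩

end Degrees

/-! ### Homogeneous substitutions, T-ideals and values of normal forms -/

section Evaluation

variable {F A X : Type*} [Field F] [Ring A] [Algebra F A]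

theorem prod_mem_of_mul_mem {𝒜 : ℤ → Submodule F A} [SetLike.GradedMonoid 𝒜] {a : ℤ × ℕ → A}
    (ha : ∀ x, a x ∈ 𝒜 x.1) (l : List (ℤ × ℕ)) :
    (l.map a).prod ∈ 𝒜 (l.map Prod.fst).sum := by
  induction l with
  | nil => simpa using SetLike.GradedOne.one_mem
  | cons x l ih =>
    simp only [List.map_cons, List.prod_cons, List.sum_cons]
    exact SetLike.GradedMul.mul_mem (ha x) ih

/-- A homogeneous substitution respects the degrees. -/
theorem lift_mem_of_mem_freeComponent {𝒜 : ℤ → Submodule F A} [SetLike.GradedMonoid 𝒜]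
    {a : ℤ × ℕ → A} (ha : ∀ x, a x ∈ 𝒜 x.1) {g : ℤ} {f : FreeGraded F}
    (hf : f ∈ freeComponent F g) : FreeAlgebra.lift F a f ∈ 𝒜 g := by
  have h : freeComponent F g ≤ (𝒜 g).comap (FreeAlgebra.lift F a).toLinearMap := by
    rw [freeComponent, Submodule.span_le]
    rintro _ ⟨l, rfl, rfl⟩
    simpa [map_list_prod, Function.comp_def] using prod_mem_of_mul_mem ha l
  exact h hf

instance freeComponent_gradedMonoid : SetLike.GradedMonoid (freeComponent F) where
  one_mem := Submodule.subset_span ⟨[], by simp⟩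
  mul_mem := by
    intro i j f g hf hg
    have := Submodule.mul_mem_mul hf hg
    rw [freeComponent, freeComponent, Submodule.span_mul_span] at this
    refine Submodule.span_mono ?_ this
    rintro _ ⟨_, ⟨l, rfl, rfl⟩, _, ⟨l', rfl, rfl⟩, rfl⟩
    exact ⟨l ++ l', by simp, by simp⟩

theorem ι_mem_freeComponent (x : ℤ × ℕ) : FreeAlgebra.ι F x ∈ freeComponent F x.1 :=
  Submodule.subset_span ⟨[x], by simp⟩

theorem mem_gradedIdentities {𝒜 : ℤ → Submodule F A} [GradedAlgebra 𝒜] {f : FreeGraded F} :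
    f ∈ gradedIdentities 𝒜 ↔
      ∀ a : ℤ × ℕ → A, (∀ x, a x ∈ 𝒜 x.1) → FreeAlgebra.lift F a f = 0 := by
  rw [gradedIdentities, TwoSidedIdeal.mem_mk']
  rfl

theorem isTIdeal_gradedIdentities (𝒜 : ℤ → Submodule F A) [GradedAlgebra 𝒜] :
    IsTIdeal (gradedIdentities 𝒜) := by
  intro φ hφ f hf
  rw [mem_gradedIdentities] at hf ⊢
  intro a ha
  have e : (FreeAlgebra.lift F a).comp φ =
      FreeAlgebra.lift F fun x => FreeAlgebra.lift F a (φ (FreeAlgebra.ι F x)) := by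
    ext x; simp
  have := hf (fun x => FreeAlgebra.lift F a (φ (FreeAlgebra.ι F x))) fun x =>
    lift_mem_of_mem_freeComponent ha (hφ _ _ (ι_mem_freeComponent x))
  rwa [← e] at this

theorem isTIdeal_tIdealSpan (S : Set (FreeGraded F)) : IsTIdeal (tIdealSpan S) := by
  intro φ hφ f hf
  rw [tIdealSpan, TwoSidedIdeal.mem_sInf] at hf ⊢
  exact fun I hI => hI.1 φ hφ f (hf I hI)

theorem subset_tIdealSpan (S : Set (FreeGraded F)) : S ⊆ tIdealSpan S := by
  intro f hf
  rw [SetLike.mem_coe, tIdealSpan, TwoSidedIdeal.mem_sInf]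
  exact fun I hI => hI.2 hf

theorem tIdealSpan_le {S : Set (FreeGraded F)} {I : TwoSidedIdeal (FreeGraded F)}
    (hI : IsTIdeal I) (hS : S ⊆ I) : tIdealSpan S ≤ I :=
  sInf_le ⟨hI, hS⟩

/-- Monomials are homogeneous, so a graded endomorphism can send three variables of the same degrees
to them. The indices 1, 2, 3 keep these variables distinct even when degrees coincide. -/
theorem lie_lie_prod_mem (l₁ l₂ l₃ : List (ℤ × ℕ)) :
    ⁅⁅(l₁.map (FreeAlgebra.ι F)).prod, (l₂.map (FreeAlgebra.ι F)).prod⁆,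
      (l₃.map (FreeAlgebra.ι F)).prod⁆ ∈ tIdealSpan (tripleCommutators F) := by
  let deg : List (ℤ × ℕ) → ℤ := fun l => (l.map Prod.fst).sum
  let v : ℤ × ℕ → FreeGraded F := fun x =>
    if x = (deg l₁, 1) then (l₁.map (FreeAlgebra.ι F)).prod
    else if x = (deg l₂, 2) then (l₂.map (FreeAlgebra.ι F)).prod
    else if x = (deg l₃, 3) then (l₃.map (FreeAlgebra.ι F)).prod
    else FreeAlgebra.ι F x
  have hv : ∀ x, v x ∈ freeComponent F x.1 := by
    intro x
    simp only [v]
    split_ifs with h h h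
    · rw [h]; exact Submodule.subset_span ⟨l₁, rfl, rfl⟩
    · rw [h]; exact Submodule.subset_span ⟨l₂, rfl, rfl⟩
    · rw [h]; exact Submodule.subset_span ⟨l₃, rfl, rfl⟩
    · exact ι_mem_freeComponent x
  have := isTIdeal_tIdealSpan (tripleCommutators F) (FreeAlgebra.lift F v)
    (fun g f hf => lift_mem_of_mem_freeComponent hv hf) _
    (subset_tIdealSpan _ ⟨deg l₁, deg l₂, deg l₃, rfl⟩)
  simpa [Ring.lie_def, var, v] using this

/-- In the quotient by the `T_ℤ`-ideal all triple commutators vanish. -/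
theorem lie_lie_eq_zero_of_quotient
    (a b c : (tIdealSpan (tripleCommutators F)).ringCon.Quotient) : ⁅⁅a, b⁆, c⁆ = 0 := by
  set π := (tIdealSpan (tripleCommutators F)).ringCon.mkₐ (α := F) with hπ
  have hsurj : Function.Surjective π := RingCon.mkₐ_surjective _
  have hker : ∀ f, f ∈ tIdealSpan (tripleCommutators F) → π f = 0 := fun f hf =>
    (RingCon.eq _).mpr hf
  -- Graded endomorphisms reach only homogeneous arguments; general ones are handled by trilinearity
  -- from monomials.
  have hspan : ∀ a, a ∈ Submodule.span F
      (Set.range fun l : List (ℤ × ℕ) => π ((l.map (FreeAlgebra.ι F)).prod)) := by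
    intro a
    obtain ⟨f, rfl⟩ := hsurj a
    have hf : f ∈ Submodule.span F
        (Set.range fun l : List (ℤ × ℕ) => (l.map (FreeAlgebra.ι F)).prod) := by
      rw [span_monomials_eq_top]; trivial
    have := Submodule.mem_map_of_mem (f := π.toLinearMap) hf
    rw [Submodule.map_span, ← Set.range_comp] at this
    exact this
  induction hspan a using Submodule.span_induction with
  | zero => simp [Ring.lie_def]
  | add a a' _ _ h h' =>
    rw [show ⁅⁅a + a', b⁆, c⁆ = ⁅⁅a, b⁆, c⁆ + ⁅⁅a', b⁆, c⁆ by
      simp only [Ring.lie_def]; noncomm_ring, h, h', add_zero]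
  | smul r a _ h =>
    rw [show ⁅⁅r • a, b⁆, c⁆ = r • ⁅⁅a, b⁆, c⁆ by simp [Ring.lie_def, smul_sub, sub_mul, mul_sub],
      h, smul_zero]
  | mem a ha =>
  obtain ⟨l₁, rfl⟩ := ha
  induction hspan b using Submodule.span_induction with
  | zero => simp [Ring.lie_def]
  | add b b' _ _ h h' =>
    rw [show ∀ a, ⁅⁅a, b + b'⁆, c⁆ = ⁅⁅a, b⁆, c⁆ + ⁅⁅a, b'⁆, c⁆ by
      intro a; simp only [Ring.lie_def]; noncomm_ring, h, h', add_zero]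
  | smul r b _ h =>
    rw [show ∀ a, ⁅⁅a, r • b⁆, c⁆ = r • ⁅⁅a, b⁆, c⁆ by
      simp [Ring.lie_def, smul_sub, sub_mul, mul_sub], h, smul_zero]
  | mem b hb =>
  obtain ⟨l₂, rfl⟩ := hb
  induction hspan c using Submodule.span_induction with
  | zero => simp [Ring.lie_def]
  | add c c' _ _ h h' =>
    rw [show ∀ a, ⁅a, c + c'⁆ = ⁅a, c⁆ + ⁅a, c'⁆ by
      intro a; simp only [Ring.lie_def]; noncomm_ring, h, h', add_zero]
  | smul r c _ h =>
    rw [show ∀ a, ⁅a, r • c⁆ = r • ⁅a, c⁆ by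
      simp [Ring.lie_def, smul_sub], h, smul_zero]
  | mem c hc =>
    obtain ⟨l₃, rfl⟩ := hc
    simpa [Ring.lie_def] using hker _ (lie_lie_prod_mem l₁ l₂ l₃)

/-- Every polynomial is a linear combination of normal forms modulo the `T_ℤ`-ideal. -/
theorem exists_sub_normalForm_mem (f : FreeGraded F) :
    ∃ c : (Multiset (ℤ × ℕ) × Finset (ℤ × ℕ)) →₀ F,
      f - c.sum (fun p r => r • normalForm (FreeAlgebra.ι F) p) ∈
        tIdealSpan (tripleCommutators F) := by
  set π := (tIdealSpan (tripleCommutators F)).ringCon.mkₐ (α := F) with hπ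
  have h := lift_mem_span_normalForm lie_lie_eq_zero_of_quotient
    (fun x => π (FreeAlgebra.ι F x)) f
  rw [Finsupp.mem_span_range_iff_exists_finsupp] at h
  obtain ⟨c, hc⟩ := h
  refine ⟨c, ?_⟩
  rw [← TwoSidedIdeal.rel_iff]
  refine (RingCon.eq _).mp ?_
  change π f = π _
  have e : FreeAlgebra.lift F (fun x => π (FreeAlgebra.ι F x)) = π := by ext x; simp
  rw [e] at hc
  rw [← hc, Finsupp.sum, Finsupp.sum, map_sum]
  simp [map_normalForm]

/-- Central parts drop out of commutators, and `⁅q i, q j⁆ = 2 q i q j` by anticommutation. -/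
theorem commProd_add_eq {p q : X → A} (hp : ∀ i, p i ∈ Subalgebra.center F A)
    (hq : ∀ i j, q i * q j = -(q j * q i)) : ∀ l : List X, Even l.length →
      commProd (fun i => p i + q i) l = (2 : F) ^ (l.length / 2) • (l.map q).prod
  | [], _ => by simp [commProd]
  | [_], h => by simp at h
  | i :: j :: l, h => by
    have hl : Even l.length := by
      simp only [List.length_cons] at h
      grind
    have hi := Subalgebra.mem_center_iff.mp (hp i)
    have hj := Subalgebra.mem_center_iff.mp (hp j)
    have e : ⁅p i + q i, p j + q j⁆ = (2 : F) • (q i * q j) := by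
      rw [Ring.lie_def, add_mul, mul_add, mul_add, add_mul, mul_add, mul_add, ← hi (p j),
        ← hi (q j), hj (q i), hq j i, two_smul]
      abel
    simp only [commProd, e, commProd_add_eq hp hq l hl, List.map_cons, List.prod_cons,
      List.length_cons, smul_mul_smul_comm]
    rw [show (l.length + 1 + 1) / 2 = l.length / 2 + 1 by omega, pow_succ', mul_assoc]

theorem mul_prod_eq_zero_of_mem {q : X → A} (hq : ∀ i j, q i * q j = -(q j * q i))
    (hq' : ∀ i, q i * q i = 0) {i : X} : ∀ {l : List X}, i ∈ l → q i * (l.map q).prod = 0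
  | j :: l, h => by
    rw [List.map_cons, List.prod_cons, ← mul_assoc]
    rcases List.mem_cons.mp h with rfl | h
    · rw [hq', zero_mul]
    · rw [hq, neg_mul, mul_assoc, mul_prod_eq_zero_of_mem hq hq' h, mul_zero, neg_zero]

/-- Each `q i` is killed by the product over `L`: it repeats a factor if `i ∈ L` and is zero
otherwise. Only the central parts survive. -/
theorem prod_add_mul_prod_eq {p q : X → A} (hp : ∀ i, p i ∈ Subalgebra.center F A)
    (hq : ∀ i j, q i * q j = -(q j * q i)) (hq' : ∀ i, q i * q i = 0) {L : List X}
    (hL : ∀ i, i ∉ L → q i = 0) (l : List X) :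
    (l.map fun i => p i + q i).prod * (L.map q).prod = (l.map p).prod * (L.map q).prod := by
  induction l with
  | nil => simp
  | cons i l ih =>
    have hc : (l.map p).prod ∈ Subalgebra.center F A :=
      list_prod_mem fun a ha => by
        obtain ⟨j, -, rfl⟩ := List.mem_map.mp ha
        exact hp j
    have hz : q i * (L.map q).prod = 0 := by
      by_cases hi : i ∈ L
      · exact mul_prod_eq_zero_of_mem hq hq' hi
      · rw [hL i hi, zero_mul]
    simp only [List.map_cons, List.prod_cons]
    rw [mul_assoc, ih, add_mul, ← mul_assoc (q i), Subalgebra.mem_center_iff.mp hc, mul_assoc _ (q i),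
      hz, mul_zero, add_zero, mul_assoc]

/-- The value of a normal form at elements whose noncentral part is supported on the indices of
the commutators. -/
theorem normalForm_add_eq {p : X → Subalgebra.center F A} {q : X → A}
    (hq : ∀ i j, q i * q j = -(q j * q i)) (hq' : ∀ i, q i * q i = 0)
    (a : Multiset X) {J : Finset X} (hJ : Even J.card) (hL : ∀ i, i ∉ J → q i = 0) :
    normalForm (fun i => (p i : A) + q i) (a, J) =
      (2 : F) ^ (J.card / 2) • (((a.map p).prod : Subalgebra.center F A) *
        (J.toList.map q).prod : A) := by
  rw [normalForm, commProd_add_eq (F := F) (fun i => (p i).2) hq _ (by simpa using hJ),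
    mul_smul_comm, prod_add_mul_prod_eq (F := F) (fun i => (p i).2) hq hq' (by simpa using hL)]
  congr 2
  · simp
  · conv_rhs => rw [← Multiset.coe_toList a, Multiset.map_coe, Multiset.prod_coe]
    rw [← Subalgebra.val_apply, map_list_prod, List.map_map]
    rfl

theorem normalForm_add_eq_zero {p : X → Subalgebra.center F A} {q : X → A}
    (hq : ∀ i j, q i * q j = -(q j * q i))
    (a : Multiset X) {J : Finset X} {i : X} (hi : i ∈ J) (hi' : q i = 0) :
    normalForm (fun i => (p i : A) + q i) (a, J) = 0 := by
  rw [normalForm]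
  rcases Nat.even_or_odd J.card with hJ | hJ
  · rw [commProd_add_eq (F := F) (fun i => (p i).2) hq _ (by simpa using hJ),
      List.prod_eq_zero (List.mem_map.mpr ⟨i, by simpa using hi, hi'⟩), smul_zero, mul_zero]
  · rw [commProd_of_odd _ _ (by simpa using hJ), mul_zero]

end Evaluation

/-! ### Independence of the normal forms on the Grassmann algebra -/

section Coefficients

variable {F : Type*} [Field F]

open Classical in
theorem isMonomialMultiple_finsetProd {κ : Type*} {z : κ → Subalgebra.center F (Grassmann F)}
    {S : κ → Finset ℕ} (hS : Pairwise fun i j => Disjoint (S i) (S j)) (T : Finset κ)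
    (hz : ∀ i ∈ T, IsMonomialMultiple F (z i : Grassmann F) (S i)) :
    IsMonomialMultiple F ((∏ i ∈ T, z i : Subalgebra.center F (Grassmann F)) : Grassmann F)
      (T.biUnion S) := by
  have h := isMonomialMultiple_prod hS T.toList T.nodup_toList (by simpa using hz)
  rw [Finset.toList_toFinset] at h
  rw [← Finset.prod_map_toList, ← Subalgebra.val_apply, map_list_prod, List.map_map]
  exact h

variable [CharZero F]

open Classical in
/-- A linear combination of normal forms that vanishes under all homogeneous substitutions in the
Grassmann algebra has zero coefficients. -/
theorem coeff_eq_zero_of_vanishes {d : ℕ → ℤ} {S : ℤ × Bool × ℕ → Finset ℕ}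
    (hS : Pairwise fun i j => Disjoint (S i) (S j))
    (hS' : ∀ k, (S k).Nonempty ∧ monomialDegree d (S k) = k.1 ∧
      (Even (S k).card ↔ k.2.1 = true))
    (c : (Multiset (ℤ × ℕ) × Finset (ℤ × ℕ)) →₀ F)
    (hc : ∀ u : ℤ × ℕ → Grassmann F, (∀ x, u x ∈ component F d x.1) →
      c.sum (fun p r => r • normalForm u p) = 0) (j k : ℕ) :
    ∀ (a : Multiset (ℤ × ℕ)) (J : Finset (ℤ × ℕ)), J.card = j → a.card = k → Even J.card →
      c (a, J) = 0 := by
  -- Outer induction on the size of `J`, for all `a` at once; inner induction on the size of `a`.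
  induction j using Nat.strong_induction_on generalizing k with
  | _ j ihj =>
  induction k using Nat.strong_induction_on with
  | _ k ihk =>
  intro a₀ J₀ hj hk hJ₀
  -- Pairing reserves infinitely many even monomials, of the right degree, for each variable.
  let e : ℤ × ℕ → ℕ → ℤ × Bool × ℕ := fun x i => (x.1, true, Nat.pair x.2 i)
  have he : ∀ {x y i i'}, e x i = e y i' → x = y ∧ i = i' := by
    intro x y i i' h
    simp only [e, Prod.mk.injEq, true_and, Nat.pair_eq_pair] at h
    exact ⟨Prod.ext h.1 h.2.1, h.2.2⟩
  let w : ℤ × ℕ → ℕ → Subalgebra.center F (Grassmann F) := fun x i =>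
    ⟨monomialBasis F (S (e x i)), monomialBasis_mem_center F ((hS' (e x i)).2.2.mpr rfl)⟩
  have hw : ∀ x i, w x i * w x i = 0 := fun x i => Subtype.ext <|
    monomialBasis_mul_of_not_disjoint F fun h => (hS' (e x i)).1.ne_empty (disjoint_self.mp h)
  let p : ℤ × ℕ → Subalgebra.center F (Grassmann F) := fun x =>
    ∑ i ∈ Finset.range (a₀.count x), w x i
  let o : ℤ × ℕ → ℤ × Bool × ℕ := fun x => (x.1, false, x.2)
  have ho : Function.Injective o := by
    intro x y h
    simp only [o, Prod.mk.injEq, true_and] at h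
    exact Prod.ext h.1 h.2
  have hodd : ∀ x, Odd (S (o x)).card := fun x => by
    rw [← Nat.not_even_iff_odd, (hS' (o x)).2.2]
    simp [o]
  let q : ℤ × ℕ → Grassmann F := fun x => if x ∈ J₀ then monomialBasis F (S (o x)) else 0
  have hq : ∀ x y, q x * q y = -(q y * q x) := by
    intro x y
    simp only [q]
    split_ifs <;> simp [monomialBasis_anticomm F (hodd x) (hodd y)]
  have hq' : ∀ x, q x * q x = 0 := by
    intro x
    simp only [q]
    split_ifs
    · exact monomialBasis_mul_of_not_disjoint F fun h =>
        (hS' (o x)).1.ne_empty (disjoint_self.mp h)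
    · simp
  have hmem : ∀ x, (p x : Grassmann F) + q x ∈ component F d x.1 := by
    intro x
    refine add_mem ?_ ?_
    · simp only [p]
      rw [AddSubmonoidClass.coe_finsetSum]
      refine sum_mem fun i _ => ?_
      have := monomialBasis_mem F d (S (e x i))
      rwa [(hS' (e x i)).2.1] at this
    · simp only [q]
      split_ifs
      · have := monomialBasis_mem F d (S (o x))
        rwa [(hS' (o x)).2.1] at this
      · exact zero_mem _
  have hsum := hc _ hmem
  rw [Finsupp.sum, Finset.sum_eq_single (a₀, J₀)] at hsum
  · refine (smul_eq_zero.mp hsum).resolve_right ?_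
    rw [normalForm_add_eq (F := F) hq hq' a₀ hJ₀ fun x hx => if_neg hx]
    refine smul_ne_zero (pow_ne_zero _ two_ne_zero) ?_
    have hpow : ∀ x, IsMonomialMultiple F
        ((p x ^ a₀.count x : Subalgebra.center F (Grassmann F)) : Grassmann F)
        ((Finset.range (a₀.count x)).biUnion fun i => S (e x i)) := by
      intro x
      have h := (isMonomialMultiple_finsetProd (F := F) (z := w x) (S := fun i => S (e x i))
        -- Characteristic zero keeps the factor `(a₀.count x)!` below nonzero.
        (fun i i' hi => hS fun h => hi (he h).2) (Finset.range (a₀.count x))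
        fun i _ => isMonomialMultiple_monomialBasis _).smul
        (c := ((a₀.count x).factorial : F)) (by exact_mod_cast Nat.factorial_ne_zero _)
      rw [(sum_pow_of_sq_zero (w x) (hw x) _).2]
      convert h using 1
      rw [Nat.cast_smul_eq_nsmul, nsmul_eq_mul]
      simp
    have h₁ := isMonomialMultiple_finsetProd (F := F) (fun x y hxy => by
      simp only [Finset.disjoint_biUnion_left, Finset.disjoint_biUnion_right]
      intro i _
      exact fun i' _ => hS fun h => hxy (he h).1) a₀.toFinset fun x _ => hpow x
    rw [← Finset.prod_multiset_map_count] at h₁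
    have h₂ := isMonomialMultiple_prod (F := F) (z := q) (S := fun x => S (o x))
      (fun x y hxy => hS (ho.ne hxy)) J₀.toList J₀.nodup_toList fun x hx => by
        simp only [q]
        rw [if_pos (by simpa using hx)]
        exact isMonomialMultiple_monomialBasis _
    refine (h₁.mul h₂ ?_).ne_zero
    simp only [Finset.disjoint_biUnion_left, Finset.disjoint_biUnion_right]
    intro x _ y _ i _
    exact hS fun h => by simp [e, o] at h
  · rintro ⟨a, J⟩ - hne
    rcases Nat.even_or_odd J.card with hJ | hJ
    swap
    · rw [normalForm, commProd_of_odd _ _ (by simpa using hJ), mul_zero, smul_zero]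
    by_cases hsub : J ⊆ J₀
    swap
    · obtain ⟨x, hx, hx'⟩ := Finset.not_subset.mp hsub
      rw [normalForm_add_eq_zero (F := F) hq a hx (if_neg hx'), smul_zero]
    by_cases hlt : J.card < j
    · rw [ihj _ hlt a.card a J rfl rfl hJ, zero_smul]
    obtain rfl : J = J₀ := Finset.eq_of_subset_of_card_le hsub (by omega)
    by_cases hlt' : a.card < k
    · rw [ihk _ hlt' a J hj rfl hJ, zero_smul]
    -- Here `J = J₀` and `a` has at least as many elements as `a₀`, so `a ≤ a₀` would force
    -- equality. The excess multiplicity makes a power of `p x` vanish.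
    obtain ⟨x, hx⟩ : ∃ x, a₀.count x < a.count x := by
      by_contra! hle
      exact hne (by rw [Multiset.eq_of_le_of_card_le (Multiset.le_iff_count.mpr hle) (by omega)])
    have hpx : p x ^ a.count x = 0 :=
      pow_eq_zero_of_le hx (sum_pow_of_sq_zero (w x) (hw x) _).1
    have hprod : (a.map p).prod = 0 := by
      rw [Finset.prod_multiset_map_count]
      exact Finset.prod_eq_zero
        (Multiset.mem_toFinset.mpr (Multiset.count_pos.mp (Nat.zero_lt_of_lt hx))) hpx
    rw [normalForm_add_eq (F := F) hq hq' a hJ fun x hx => if_neg hx, hprod]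
    simp
  · intro h
    rw [Finsupp.notMem_support_iff.mp h, zero_smul]

theorem generatesVarietyOf_tripleCommutators {d : ℕ → ℤ} {S : ℤ × Bool × ℕ → Finset ℕ}
    (hS : Pairwise fun i j => Disjoint (S i) (S j))
    (hS' : ∀ k, (S k).Nonempty ∧ monomialDegree d (S k) = k.1 ∧
      (Even (S k).card ↔ k.2.1 = true)) :
    GeneratesVarietyOf (component F d) (tripleCommutators F) := by
  have hle : tIdealSpan (tripleCommutators F) ≤ gradedIdentities (component F d) := by
    refine tIdealSpan_le (isTIdeal_gradedIdentities _) ?_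
    rintro _ ⟨x, y, z, rfl⟩
    rw [SetLike.mem_coe, mem_gradedIdentities]
    intro a _
    have := lie_lie_eq_zero F (a (x, 1)) (a (y, 2)) (a (z, 3))
    simpa [Ring.lie_def, var] using this
  refine le_antisymm hle fun f hf => ?_
  obtain ⟨c, hc⟩ := exists_sub_normalForm_mem f
  have hvan : ∀ u : ℤ × ℕ → Grassmann F, (∀ x, u x ∈ component F d x.1) →
      c.sum (fun p r => r • normalForm u p) = 0 := by
    intro u hu
    have h := mem_gradedIdentities.mp (hle hc) u hu
    rw [map_sub, mem_gradedIdentities.mp hf u hu, zero_sub, neg_eq_zero, Finsupp.sum,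
      map_sum] at h
    simpa [map_normalForm, Finsupp.sum] using h
  -- For odd `J` the coefficient is not controlled, but the normal form itself is zero.
  have h₀ : c.sum (fun p r => r • normalForm (FreeAlgebra.ι F) p) = 0 := by
    refine Finset.sum_eq_zero fun p _ => ?_
    beta_reduce
    rcases Nat.even_or_odd p.2.card with h | h
    · rw [show c p = 0 from coeff_eq_zero_of_vanishes hS hS' c hvan _ _ p.1 p.2 rfl rfl h,
        zero_smul]
    · rw [normalForm, commProd_of_odd _ _ (by simpa using h), mul_zero, smul_zero]
  rwa [h₀, sub_zero] at hc

end Coefficients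

end GradedGrassmann

theorem theorem3p12 {F : Type*} [Field F] [CharZero F] (m n : ℤ) (hm : m < 0) (hn : 0 < n)
    (hmn : Even (m * n)) (α β α' β' : ℕ)
    (h_one : (1 : ℤ) = α * m + β * n) (h_neg_one : (-1 : ℤ) = α' * m + β' * n)
    (h_odd : Odd (α + β)) (h_odd' : Odd (α' + β'))
    (d : ℕ → ℤ) (hd : GradedGrassmann.IsTwoInduced d m n) :
    GradedGrassmann.GeneratesVarietyOf (GradedGrassmann.component F d)
      (GradedGrassmann.tripleCommutators F) ∧
    ∀ r : ℤ, ∃ W : Set (Finset ℕ), W.PairwiseDisjoint id ∧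
      (∀ s ∈ W, GradedGrassmann.monomialBasis F s ∈ GradedGrassmann.component F d r) ∧
      {s ∈ W | Even s.card}.Infinite ∧ {s ∈ W | Odd s.card}.Infinite := by
  obtain ⟨S, hS, hS'⟩ :=
    GradedGrassmann.exists_disjoint_supports hm hn hmn h_one h_neg_one hd
  refine ⟨GradedGrassmann.generatesVarietyOf_tripleCommutators hS hS', fun r => ?_⟩
  have hinj : Function.Injective S := fun i j h => by
    by_contra hij
    have : Disjoint (S i) (S j) := hS hij
    rw [h] at this
    exact (hS' j).1.ne_empty (disjoint_self.mp this)
  refine ⟨Set.range fun k : Bool × ℕ => S (r, k), ?_, ?_, ?_, ?_⟩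
  · rintro _ ⟨i, rfl⟩ _ ⟨j, rfl⟩ hij
    exact hS fun h => hij (congrArg S h)
  · rintro _ ⟨k, rfl⟩
    have := GradedGrassmann.monomialBasis_mem F d (S (r, k))
    rwa [(hS' (r, k)).2.1] at this
  · refine (Set.infinite_range_of_injective (f := fun k : ℕ => S (r, true, k))
      fun i j h => by simpa using hinj h).mono ?_
    rintro _ ⟨k, rfl⟩
    exact ⟨⟨(true, k), rfl⟩, (hS' (r, true, k)).2.2.mpr rfl⟩
  · refine (Set.infinite_range_of_injective (f := fun k : ℕ => S (r, false, k))
      fun i j h => by simpa using hinj h).mono ?_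
    rintro _ ⟨k, rfl⟩
    refine ⟨⟨(false, k), rfl⟩, ?_⟩
    rw [← Nat.not_even_iff_odd, (hS' (r, false, k)).2.2]
    simp
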